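/- Let $L$ be a locally compact second countable (Hausdorff) topological group, let $T$ be a torus (a topological group isomorphic to $(S^1)^k$ for some $k\ge 0$) contained in the center of $L$, and let $R$ be a closed normal subgroup of $L$ such that $W=L/R$ is a vector group (isomorphic as a topological group to $\mathbb R^n$ for some $n\ge 0$, and regarded as a real vector space in this way). Let $\theta:L\to W$ be the quotient homomorphism. Let $\mathrm{Hom}(W,T)$ be the group of continuous homomorphisms from $W$ to $T$ under pointwise multiplication, with the compact-open topology. For $\alpha\in\mathrm{Hom}(W,T)$ let $\tilde\alpha$ be the (shear) automorphism $g\mapsto g\,\alpha(gR)$ of $L$. For a finite Borel measure $\mu$ on $L$ and a Borel map $f$ on $L$ write $f(\mu)$ for the image measure, and let $X(\mu)=\{\alpha\in\mathrm{Hom}(W,T): \tilde\alpha(\mu)=\mu\}$, a subgroup of $\mathrm{Hom}(W,T)$. A finite measure $\lambda$ on $W$ is called pure if every vector subspace of $W$ of positive $\lambda$-measure contains the linear span of $\operatorname{supp}\lambda$. The decomposition of a finite measure on $W$ into pure components is its expression as a finite or countably infinite sum of nonzero pure measures such that the spans of the supports of any two distinct summands are distinct. **Theorem.** Let $\mu$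 be a finite Borel measure on $L$, let $\theta(\mu)=\sum_{i\in I}\lambda_i$ be the decomposition of $\theta(\mu)$ into pure components, and for each $i\in I$ let $W_i$ be the linear span of $\operatorname{supp}\lambda_i$. Suppose that for every $i\in I$ there is an integer $d_i\ge 1$ such that the convolution power $\lambda_i^{d_i}$ has a density with respect to the Lebesgue measure on $W_i$. Let $(\alpha_j)_{j\in\mathbb N}$ be a sequence in $\mathrm{Hom}(W,T)$ such that $(\tilde\alpha_j(\mu))_j$ converges weakly to $\tau(\mu)$ for some continuous automorphism $\tau$ of $L$ with $\tau(t)=t$ for all $t\in T$. Then the sequence $(\alpha_jX(\mu))_j$ is relatively compact in the quotient $\mathrm{Hom}(W,T)/X(\mu)$, that is, the set of its terms has compact closure. -/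

import Mathlib

open MeasureTheory Filter Topology

namespace ShearAsymptotics

/-- `T` is a torus (isomorphic, as a topological group, to a finite power of the circle group)
contained in the center of `L`. -/
class IsCentralTorus {L : Type*} [Group L] [TopologicalSpace L] (T : Subgroup L) : Prop where
  le_center : T ≤ Subgroup.center L
  isTorus : ∃ k : ℕ, Nonempty (T ≃ₜ* (Fin k → Circle))

/-- A central torus is a commutative group. -/
instance {L : Type*} [Group L] [TopologicalSpace L] (T : Subgroup L) [IsCentralTorus T] :
    CommGroup T :=
  { (inferInstance : Group T) with
    mul_comm := fun a b =>
      Subtype.ext ((Subgroup.mem_center_iff.1 (IsCentralTorus.le_center b.2)) (a : L)) }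

/-- A vector group has no nontrivial compact subgroup, so `T` is contained in the kernel of any
continuous homomorphism to a vector group. -/
theorem torus_le {L : Type*} [Group L] [TopologicalSpace L] {T R : Subgroup L}
    [IsCentralTorus T] [R.Normal] {n : ℕ}
    (e : (L ⧸ R) ≃ₜ* Multiplicative (EuclideanSpace ℝ (Fin n))) : T ≤ R := by
  obtain ⟨k, ⟨f⟩⟩ := IsCentralTorus.isTorus (T := T)
  have : CompactSpace T := f.symm.toHomeomorph.compactSpace
  intro t ht
  let φ : T → EuclideanSpace ℝ (Fin n) := fun s =>
    Multiplicative.toAdd (e (QuotientGroup.mk (s : L)))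
  have hφ : Continuous φ :=
    continuous_toAdd.comp (e.continuous.comp
      (continuous_quotient_mk'.comp continuous_subtype_val))
  have hpow : ∀ m : ℕ, φ (⟨t, ht⟩ ^ m) = (m : ℝ) • φ ⟨t, ht⟩ := by
    intro m
    simp only [φ, SubmonoidClass.mk_pow, QuotientGroup.mk_pow, map_pow, toAdd_pow,
      Nat.cast_smul_eq_nsmul]
  obtain ⟨C, hC⟩ := (isCompact_range hφ).isBounded.exists_norm_le
  have h0 : φ ⟨t, ht⟩ = 0 := by
    by_contra hne
    have hpos : 0 < ‖φ ⟨t, ht⟩‖ := norm_pos_iff.2 hne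
    obtain ⟨m, hm⟩ := exists_nat_gt (C / ‖φ ⟨t, ht⟩‖)
    have h1 := hC _ ⟨⟨t, ht⟩ ^ m, rfl⟩
    rw [hpow m, norm_smul, Real.norm_natCast] at h1
    rw [div_lt_iff₀ hpos] at hm
    linarith
  have h1 : e (QuotientGroup.mk t) = 1 := h0
  have h2 : (QuotientGroup.mk t : L ⧸ R) = 1 := by simpa using h1
  exact (QuotientGroup.eq_one_iff t).1 h2

theorem mk_mul_torus {L : Type*} [Group L] [TopologicalSpace L] {T R : Subgroup L}
    [IsCentralTorus T] [R.Normal] {n : ℕ}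
    (e : (L ⧸ R) ≃ₜ* Multiplicative (EuclideanSpace ℝ (Fin n))) (g : L)
    (t : T) : (QuotientGroup.mk (g * (t : L)) : L ⧸ R) = QuotientGroup.mk g :=
  QuotientGroup.mk_mul_of_mem g (torus_le e t.2)

section Shear

variable {L : Type*} [Group L] [TopologicalSpace L] [IsTopologicalGroup L]
  {T R : Subgroup L} [IsCentralTorus T] [R.Normal] {n : ℕ}

/-- The quotient map `L → W = L / R`, read in the coordinates given by an isomorphism `e` of the
topological group `L / R` with the vector group `ℝⁿ`. -/
def quotMap (e : (L ⧸ R) ≃ₜ* Multiplicative (EuclideanSpace ℝ (Fin n))) (g : L) :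
    EuclideanSpace ℝ (Fin n) :=
  Multiplicative.toAdd (e (QuotientGroup.mk g))

/-- The shear automorphism `g ↦ g α(gR)` of `L` attached to `α ∈ Hom(L / R, T)`. The isomorphism
`e` serves only to show that this map is invertible. -/
def shear (e : (L ⧸ R) ≃ₜ* Multiplicative (EuclideanSpace ℝ (Fin n))) (α : (L ⧸ R) →ₜ* T) :
    L ≃ₜ* L where
  toFun g := g * (α (QuotientGroup.mk g) : L)
  invFun g := g * ((α (QuotientGroup.mk g))⁻¹ : T)
  left_inv g := by
    simp only [mk_mul_torus e]
    simp
  right_inv g := by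
    simp only [mk_mul_torus e]
    simp
  map_mul' g h := by
    have hc := Subgroup.mem_center_iff.1
      (IsCentralTorus.le_center (α (QuotientGroup.mk g)).2) h
    simp only [QuotientGroup.mk_mul, map_mul, Subgroup.coe_mul]
    rw [mul_assoc g h, ← mul_assoc h, hc]
    simp only [mul_assoc]
  continuous_toFun := continuous_id.mul
    (continuous_subtype_val.comp (α.continuous_toFun.comp continuous_quotient_mk'))
  continuous_invFun := continuous_id.mul
    (continuous_subtype_val.comp (α.continuous_toFun.comp continuous_quotient_mk').inv)

theorem shear_apply (e : (L ⧸ R) ≃ₜ* Multiplicative (EuclideanSpace ℝ (Fin n)))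
    (α : (L ⧸ R) →ₜ* T) (g : L) : shear e α g = g * (α (QuotientGroup.mk g) : L) := rfl

theorem shear_one (e : (L ⧸ R) ≃ₜ* Multiplicative (EuclideanSpace ℝ (Fin n))) :
    (shear e (1 : (L ⧸ R) →ₜ* T) : L → L) = id := by
  funext g
  simp [shear_apply]

theorem shear_mul (e : (L ⧸ R) ≃ₜ* Multiplicative (EuclideanSpace ℝ (Fin n)))
    (α β : (L ⧸ R) →ₜ* T) :
    (shear e (α * β) : L → L) = (shear e α : L → L) ∘ (shear e β : L → L) := by
  funext g
  have h1 : (α * β) (QuotientGroup.mk g)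
      = β (QuotientGroup.mk g) * α (QuotientGroup.mk g) := mul_comm _ _
  simp only [Function.comp_apply, shear_apply, mk_mul_torus e, h1, Subgroup.coe_mul, mul_assoc]

theorem map_shear_mul [MeasurableSpace L] [BorelSpace L]
    (e : (L ⧸ R) ≃ₜ* Multiplicative (EuclideanSpace ℝ (Fin n))) (μ : FiniteMeasure L)
    (α β : (L ⧸ R) →ₜ* T) :
    μ.map (shear e (α * β)) = (μ.map (shear e β)).map (shear e α) := by
  apply Subtype.ext
  rw [shear_mul]
  exact (Measure.map_map (shear e α).continuous.measurable
    (shear e β).continuous.measurable).symm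

/-- The subgroup `X(μ)` of all `α ∈ Hom(L / R, T)` whose shear automorphism preserves `μ`. -/
def stabilizer [MeasurableSpace L] [BorelSpace L]
    (e : (L ⧸ R) ≃ₜ* Multiplicative (EuclideanSpace ℝ (Fin n))) (μ : FiniteMeasure L) :
    Subgroup ((L ⧸ R) →ₜ* T) where
  carrier := {α | μ.map (shear e α) = μ}
  one_mem' := by
    rw [Set.mem_ofPred_eq, shear_one]
    exact Subtype.ext Measure.map_id
  mul_mem' := by
    intro α β hα hβ
    rw [Set.mem_ofPred_eq] at *
    rw [map_shear_mul, hβ, hα]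
  inv_mem' := by
    intro α hα
    rw [Set.mem_ofPred_eq] at *
    have h := map_shear_mul e μ α⁻¹ α
    rw [hα, inv_mul_cancel, shear_one] at h
    exact h.symm.trans (Subtype.ext Measure.map_id)

end Shear

section Pure

variable {n : ℕ}

/-- The linear span of the support of a measure on `ℝⁿ`. -/
def spanSupport (lam : Measure (EuclideanSpace ℝ (Fin n))) :
    Submodule ℝ (EuclideanSpace ℝ (Fin n)) :=
  Submodule.span ℝ lam.support

/-- A measure on `ℝⁿ` is pure if every vector subspace of positive measure contains the span of
the support of the measure. -/
def IsPure (lam : Measure (EuclideanSpace ℝ (Fin n))) : Prop :=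
  ∀ U : Submodule ℝ (EuclideanSpace ℝ (Fin n)),
    0 < lam (U : Set (EuclideanSpace ℝ (Fin n))) → spanSupport lam ≤ U

/-- The (finite or countably infinite) family `comp` is the decomposition of `lam` into its pure
components. -/
structure IsPureDecomposition {ι : Type*} (lam : Measure (EuclideanSpace ℝ (Fin n)))
    (comp : ι → Measure (EuclideanSpace ℝ (Fin n))) : Prop where
  countable : Countable ι
  sum_eq : Measure.sum comp = lam
  ne_zero : ∀ i, comp i ≠ 0
  pure : ∀ i, IsPure (comp i)
  span_ne : ∀ i j, i ≠ j → spanSupport (comp i) ≠ spanSupport (comp j)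

/-- The convolution power `lam ∗ ⋯ ∗ lam` with `d` factors (the Dirac mass at `0` if `d = 0`). -/
noncomputable def convPow (lam : Measure (EuclideanSpace ℝ (Fin n))) :
    ℕ → Measure (EuclideanSpace ℝ (Fin n))
  | 0 => Measure.dirac 0
  | d + 1 => (convPow lam d).conv lam

/-- `ν` has a density with respect to the Lebesgue measure on the subspace `U`. -/
def HasDensityOn (U : Submodule ℝ (EuclideanSpace ℝ (Fin n)))
    (ν : Measure (EuclideanSpace ℝ (Fin n))) : Prop :=
  ∃ f : EuclideanSpace ℝ (Fin n) → ENNReal, Measurable f ∧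
    ν = ((volume : Measure U).map Subtype.val).withDensity f

end Pure

end ShearAsymptotics

open MeasureTheory Filter Topology
open scoped BoundedContinuousFunction

set_option linter.unusedSectionVars false

namespace ShearAsymptotics

/-! ### Functions transforming under the torus by a character -/

section Equivariant

variable {L : Type*} [Group L] [TopologicalSpace L] {T : Subgroup L} [IsCentralTorus T]

/-! Call `f` of type `χ` if `f (g * t) = χ t * f g` for `t ∈ T`. Such functions determine a finite
measure on `L`, and against them a shear acts by a scalar factor: integrating `f` over the sheared
measure is integrating `f · χ(α(gR))` over `μ`. Lifting to linear forms, `α j` is the exponential of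
a vector `a j` in a finite-dimensional space, and `χ ∘ α j` is the exponential of a linear form `ℓ
j` on `W` depending linearly on `a j`.

Up to a null set, `W` splits into disjoint cells, the `i`-th lying in `W_i` and carrying exactly the
`i`-th pure component. If `ℓ j` is unbounded on `W_i`, then along indices with norm tending to
infinity the Riemann–Lebesgue lemma, applied to a convolution power, kills the contribution of cell
`i` to all integrals of type `χ`. But `τ` fixes `T`, so composition with `τ` permutes the functions
of type `χ` bounded by one, and `τ(μ)` has the same supremum of such integrals as `μ`. Nothing can
be lost: cell `i` had no mass of type `χ` (`UnitEquivariant.setIntegral_eq_zero`). So `ℓ j` is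
bounded on `W_i` whenever the pair `(χ, i)` carries mass (`exists_norm_le_of_tendsto`).

By linear algebra (`exists_bounded_linearMap`), `a j = p (a j) + (a j - p (a j))`, where the first
term is bounded and the second is killed by every linear form bounded on the sequence. The second
exponentiates into `X(μ)` (`mem_stabilizer_of_forall`), so the cosets lie in the image of a closed
ball, which is compact. -/

theorem IsCentralTorus.compactSpace (T : Subgroup L) [IsCentralTorus T] : CompactSpace T := by
  obtain ⟨k, ⟨f⟩⟩ := IsCentralTorus.isTorus (T := T)
  exact f.symm.toHomeomorph.compactSpace

/-- Continuous characters separate the points of a central torus. -/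
theorem IsCentralTorus.exists_character_ne_one {t : T} (ht : t ≠ 1) :
    ∃ χ : T →ₜ* Circle, χ t ≠ 1 := by
  obtain ⟨k, ⟨f⟩⟩ := IsCentralTorus.isTorus (T := T)
  have hf : f t ≠ 1 := fun h => ht (by simpa using h)
  obtain ⟨l, hl⟩ := Function.ne_iff.1 hf
  exact ⟨⟨(Pi.evalMonoidHom (fun _ : Fin k => Circle) l).comp f.toMulEquiv.toMonoidHom,
    (continuous_apply l).comp f.continuous⟩, hl⟩

theorem IsCentralTorus.exists_haar [IsTopologicalGroup L] [MeasurableSpace L] [BorelSpace L]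
    (T : Subgroup L) [IsCentralTorus T] :
    ∃ m : Measure T, IsProbabilityMeasure m ∧ m.IsMulLeftInvariant ∧ m.IsOpenPosMeasure := by
  have := IsCentralTorus.compactSpace T
  refine ⟨Measure.haarMeasure ⊤, ⟨?_⟩, inferInstance, inferInstance⟩
  simpa using Measure.haarMeasure_self (G := T) (K₀ := ⊤)

/-- The measurable functions on `L`, bounded by one, that transform under `T` by the character
`χ`. -/
structure UnitEquivariant [MeasurableSpace L] (χ : T →ₜ* Circle) (f : L → ℂ) : Prop where
  measurable : Measurable f
  norm_le : ∀ g, ‖f g‖ ≤ 1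
  map_mul : ∀ g (t : T), f (g * t) = χ t * f g

theorem UnitEquivariant.integrable [MeasurableSpace L] {χ : T →ₜ* Circle} {f : L → ℂ}
    (hf : UnitEquivariant χ f) (ν : Measure L) [IsFiniteMeasure ν] : Integrable f ν :=
  Integrable.of_bound hf.measurable.aestronglyMeasurable 1 (.of_forall hf.norm_le)

theorem UnitEquivariant.mul_invariant [MeasurableSpace L] {χ : T →ₜ* Circle} {f h : L → ℂ}
    (hf : UnitEquivariant χ f) (hh : Measurable h) (h1 : ∀ g, ‖h g‖ ≤ 1)
    (hT : ∀ g (t : T), h (g * t) = h g) : UnitEquivariant χ (fun g => f g * h g) where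
  measurable := hf.measurable.mul hh
  norm_le g := by
    rw [norm_mul]
    exact mul_le_one₀ (hf.norm_le g) (norm_nonneg _) (h1 g)
  map_mul g t := by rw [hf.map_mul, hT, mul_assoc]

/-- The component of `f` that transforms under `T` by the character `χ`. -/
noncomputable def typeProj [MeasurableSpace L] (m : Measure T) (χ : T →ₜ* Circle) (f : L → ℂ)
    (g : L) : ℂ :=
  ∫ t : T, (starRingEnd ℂ (χ t : ℂ)) * f (g * t) ∂m

variable [IsTopologicalGroup L] [MeasurableSpace L] [BorelSpace L]
  [SecondCountableTopology L]
  {m : Measure T} [IsProbabilityMeasure m]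
  {χ : T →ₜ* Circle}

theorem typeProj_map_mul [m.IsMulLeftInvariant] (f : L → ℂ) (g : L) (s : T) :
    typeProj m χ f (g * s) = χ s * typeProj m χ f g := by
  unfold typeProj
  rw [← integral_const_mul,
    ← integral_mul_left_eq_self (fun t : T => (χ s : ℂ) * (starRingEnd ℂ (χ t : ℂ) * f (g * t))) s]
  congr 1 with t
  have h : (χ s : ℂ) * starRingEnd ℂ (χ s : ℂ) = 1 := by
    rw [Complex.mul_conj, Circle.normSq_coe, Complex.ofReal_one]
  rw [_root_.map_mul, Circle.coe_mul, _root_.map_mul, Subgroup.coe_mul, mul_assoc g]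
  linear_combination (-starRingEnd ℂ (χ t : ℂ) * f (g * (s * t))) * h

theorem UnitEquivariant.typeProj_eq {f : L → ℂ} (hf : UnitEquivariant χ f) :
    typeProj m χ f = f := by
  funext g
  unfold typeProj
  simp_rw [hf.map_mul, ← mul_assoc, ← Complex.normSq_eq_conj_mul_self]
  simp

theorem norm_typeProj_le {f : L → ℂ} {C : ℝ} (hf : ∀ g, ‖f g‖ ≤ C) (g : L) :
    ‖typeProj m χ f g‖ ≤ C := by
  have := norm_integral_le_of_norm_le_const (μ := m)
    (f := fun t : T => (starRingEnd ℂ (χ t : ℂ)) * f (g * t)) (C := C)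
    (.of_forall fun t => by simpa [Circle.norm_coe] using hf (g * t))
  simpa [typeProj] using this

theorem continuous_character : Continuous fun t : T => (starRingEnd ℂ (χ t : ℂ)) :=
  Complex.continuous_conj.comp (continuous_subtype_val.comp χ.continuous_toFun)

theorem continuous_typeProj (f : L →ᵇ ℂ) : Continuous (typeProj m χ f) := by
  refine continuous_of_dominated (bound := fun _ => ‖f‖) (fun g => ?_) (fun g => ?_)
    (integrable_const _) ?_
  · exact (continuous_character.mul
      (f.continuous.comp (continuous_const.mul continuous_subtype_val))).aestronglyMeasurable
  · exact .of_forall fun t => by simpa [Circle.norm_coe] using f.norm_coe_le_norm (g * t)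
  · exact .of_forall fun t => continuous_const.mul
      (f.continuous.comp (continuous_id.mul continuous_const))

theorem unitEquivariant_typeProj [m.IsMulLeftInvariant] {f : L →ᵇ ℂ} (hf : ∀ g, ‖f g‖ ≤ 1) :
    UnitEquivariant χ (typeProj m χ f) where
  measurable := (continuous_typeProj f).measurable
  norm_le := norm_typeProj_le hf
  map_mul := typeProj_map_mul _

end Equivariant

/-- Truncation of a bounded continuous function to the unit disk. -/
theorem exists_unit_approx {X : Type*} [TopologicalSpace X] [NormalSpace X] [MeasurableSpace X]
    [BorelSpace X] (κ : Measure X) [IsFiniteMeasure κ] [κ.WeaklyRegular] {f : X → ℂ}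
    (hf : Measurable f) (h1 : ∀ x, ‖f x‖ ≤ 1) {ε : ℝ} (hε : 0 < ε) :
    ∃ g : X →ᵇ ℂ, (∀ x, ‖g x‖ ≤ 1) ∧ ∫ x, ‖f x - g x‖ ∂κ ≤ ε := by
  have hfi : Integrable f κ :=
    Integrable.of_bound hf.aestronglyMeasurable 1 (.of_forall h1)
  obtain ⟨g, hg, hgi⟩ := hfi.exists_boundedContinuous_integral_sub_le (half_pos hε)
  have hpos : ∀ x, 0 < max 1 ‖g x‖ := fun x => lt_max_of_lt_left one_pos
  have hcont : Continuous fun x => ((max 1 ‖g x‖ : ℝ) : ℂ)⁻¹ * g x := by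
    refine Continuous.mul (Continuous.inv₀ ?_ fun x => ?_) g.continuous
    · exact Complex.continuous_ofReal.comp (continuous_const.max g.continuous.norm)
    · exact_mod_cast (hpos x).ne'
  have hle : ∀ x, ‖((max 1 ‖g x‖ : ℝ) : ℂ)⁻¹ * g x‖ ≤ 1 := fun x => by
    rw [norm_mul, norm_inv, Complex.norm_real, Real.norm_of_nonneg (hpos x).le,
      inv_mul_le_iff₀ (hpos x), mul_one]
    exact le_max_right _ _
  refine ⟨BoundedContinuousFunction.ofNormedAddCommGroup _ hcont 1 hle, hle, ?_⟩
  -- Radial truncation moves `g x` by its excess over norm one, at most `‖f x - g x‖` as `f x` lies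
  -- in the disk. This factor two is why `g` was chosen for `ε / 2`.
  have key : ∀ x, ‖f x - ((max 1 ‖g x‖ : ℝ) : ℂ)⁻¹ * g x‖ ≤ 2 * ‖f x - g x‖ := fun x => by
    have h2 : ‖g x - ((max 1 ‖g x‖ : ℝ) : ℂ)⁻¹ * g x‖ ≤ ‖f x - g x‖ := by
      have h3 : g x - ((max 1 ‖g x‖ : ℝ) : ℂ)⁻¹ * g x
          = ((1 - (max 1 ‖g x‖)⁻¹ : ℝ) : ℂ) * g x := by push_cast; ring
      have h4 : 0 ≤ 1 - (max 1 ‖g x‖)⁻¹ := by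
        rw [sub_nonneg]; exact inv_le_one_of_one_le₀ (le_max_left _ _)
      rw [h3, norm_mul, Complex.norm_real, Real.norm_of_nonneg h4]
      rcases le_total ‖g x‖ 1 with h | h
      · simp [max_eq_left h]
      · rw [max_eq_right h, sub_mul, inv_mul_cancel₀ (by linarith), one_mul]
        have := norm_sub_norm_le (g x) (f x)
        rw [norm_sub_rev] at this
        linarith [h1 x]
    calc _ = ‖(f x - g x) + (g x - ((max 1 ‖g x‖ : ℝ) : ℂ)⁻¹ * g x)‖ := by congr 1; ring
      _ ≤ _ := norm_add_le _ _
      _ ≤ _ := by linarith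
  calc ∫ x, ‖f x - ((max 1 ‖g x‖ : ℝ) : ℂ)⁻¹ * g x‖ ∂κ
      ≤ ∫ x, 2 * ‖f x - g x‖ ∂κ :=
        integral_mono_of_nonneg (.of_forall fun _ => norm_nonneg _)
          ((hfi.sub hgi).norm.const_mul 2) (.of_forall key)
    _ ≤ ε := by rw [integral_const_mul]; linarith

/-! ### Continuous functions of type `χ` are dense in mean -/

section Density

variable {L : Type*} [Group L] [TopologicalSpace L] {T : Subgroup L} [IsCentralTorus T]
  [IsTopologicalGroup L] [MeasurableSpace L] [BorelSpace L]
  [SecondCountableTopology L] [T2Space L] [LocallyCompactSpace L]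
  {χ : T →ₜ* Circle}

/-- Approximate `f` in mean for `κ`, the average of the `T`-translates of `ν`, and project the
approximant to type `χ`. The projection fixes `f`, and its error for `ν` is at most the error before
projection for `κ`. -/
theorem UnitEquivariant.exists_continuous_approx {f : L → ℂ} (hf : UnitEquivariant χ f)
    (ν : Measure L) [IsFiniteMeasure ν] {ε : ℝ} (hε : 0 < ε) :
    ∃ h : L →ᵇ ℂ, UnitEquivariant χ h ∧ ∫ g, ‖f g - h g‖ ∂ν ≤ ε := by
  obtain ⟨m, hm, hinv, -⟩ := IsCentralTorus.exists_haar T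
  have hmul : Measurable fun p : L × T => p.1 * (p.2 : L) :=
    (measurable_fst.mul (measurable_subtype_coe.comp measurable_snd))
  let κ : Measure L := (ν.prod m).map fun p : L × T => p.1 * (p.2 : L)
  obtain ⟨φ, hφ1, hφ⟩ := exists_unit_approx κ hf.measurable hf.norm_le hε
  have hunit := unitEquivariant_typeProj (m := m) (χ := χ) hφ1
  refine ⟨BoundedContinuousFunction.ofNormedAddCommGroup _ (continuous_typeProj φ) 1 hunit.norm_le,
    hunit, le_trans ?_ hφ⟩
  change ∫ g, ‖f g - typeProj m χ φ g‖ ∂ν ≤ _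
  have hmeas : Measurable fun x => ‖f x - φ x‖ :=
    (hf.measurable.sub φ.continuous.measurable).norm
  have hbd : ∀ x, ‖f x - φ x‖ ≤ 2 := fun x =>
    (norm_sub_le _ _).trans (by linarith [hf.norm_le x, hφ1 x])
  have hint : Integrable (fun p : L × T => ‖f (p.1 * p.2) - φ (p.1 * p.2)‖) (ν.prod m) :=
    Integrable.of_bound (hmeas.comp hmul).aestronglyMeasurable 2
      (.of_forall fun p => by simpa using hbd _)
  rw [integral_map hmul.aemeasurable hmeas.aestronglyMeasurable, integral_prod _ hint]
  refine integral_mono_of_nonneg (.of_forall fun _ => norm_nonneg _) hint.integral_prod_left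
    (.of_forall fun g => ?_)
  have hsec : Measurable fun t : T => g * (t : L) := measurable_const.mul measurable_subtype_coe
  have hχ : Measurable fun t : T => (starRingEnd ℂ (χ t : ℂ)) := continuous_character.measurable
  have h1 : Integrable (fun t : T => (starRingEnd ℂ (χ t : ℂ)) * f (g * t)) m :=
    Integrable.of_bound (hχ.mul (hf.measurable.comp hsec)).aestronglyMeasurable 1
      (.of_forall fun t => by simpa [Circle.norm_coe] using hf.norm_le (g * t))
  have h2 : Integrable (fun t : T => (starRingEnd ℂ (χ t : ℂ)) * φ (g * t)) m :=
    Integrable.of_bound (hχ.mul (φ.continuous.measurable.comp hsec)).aestronglyMeasurable 1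
      (.of_forall fun t => by simpa [Circle.norm_coe] using hφ1 (g * t))
  calc ‖f g - typeProj m χ φ g‖ = ‖typeProj m χ f g - typeProj m χ φ g‖ := by
        rw [hf.typeProj_eq]
    _ = ‖∫ t : T, (starRingEnd ℂ (χ t : ℂ)) * (f (g * t) - φ (g * t)) ∂m‖ := by
        unfold typeProj
        rw [← integral_sub h1 h2]
        simp_rw [mul_sub]
    _ ≤ ∫ t : T, ‖(starRingEnd ℂ (χ t : ℂ)) * (f (g * t) - φ (g * t))‖ ∂m :=
        norm_integral_le_integral_norm _
    _ = _ := by simp [Circle.norm_coe]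

end Density

/-! ### Comparing the mass of type `χ` before and after the limit -/

section NormComparison

variable {L : Type*} [Group L] [TopologicalSpace L] {T : Subgroup L} [IsCentralTorus T]
  [MeasurableSpace L] {χ : T →ₜ* Circle}

theorem UnitEquivariant.const_mul {f : L → ℂ} (hf : UnitEquivariant χ f) {a : ℂ} (ha : ‖a‖ ≤ 1) :
    UnitEquivariant χ (fun g => a * f g) where
  measurable := hf.measurable.const_mul a
  norm_le g := by
    rw [norm_mul]
    exact mul_le_one₀ ha (norm_nonneg _) (hf.norm_le g)
  map_mul g t := by rw [hf.map_mul, mul_left_comm]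

theorem UnitEquivariant.piecewise {E : Set L} (hE : MeasurableSet E)
    (hET : ∀ (g : L) (t : T), g * (t : L) ∈ E ↔ g ∈ E) [DecidablePred (· ∈ E)] {f f' : L → ℂ}
    (hf : UnitEquivariant χ f) (hf' : UnitEquivariant χ f') :
    UnitEquivariant χ (E.piecewise f f') where
  measurable := hf.measurable.piecewise hE hf'.measurable
  norm_le g := by
    by_cases h : g ∈ E
    · simpa [h] using hf.norm_le g
    · simpa [h] using hf'.norm_le g
  map_mul g t := by
    by_cases h : g ∈ E
    · rw [Set.piecewise_eq_of_mem _ _ _ ((hET g t).2 h), Set.piecewise_eq_of_mem _ _ _ h,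
        hf.map_mul]
    · rw [Set.piecewise_eq_of_notMem _ _ _ (mt (hET g t).1 h),
        Set.piecewise_eq_of_notMem _ _ _ h, hf'.map_mul]

theorem UnitEquivariant.comp_mulEquiv {f : L → ℂ} (hf : UnitEquivariant χ f) (σ : L ≃* L)
    (hσ : Measurable σ) (hσT : ∀ t ∈ T, σ t = t) : UnitEquivariant χ (fun g => f (σ g)) where
  measurable := hf.measurable.comp hσ
  norm_le g := hf.norm_le _
  map_mul g t := by rw [_root_.map_mul, hσT t t.2, hf.map_mul]

/-- Open mapping theorem for σ-compact groups. -/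
theorem continuous_mulEquiv_symm {L : Type*} [Group L] [TopologicalSpace L] [IsTopologicalGroup L]
    [T2Space L] [LocallyCompactSpace L] [SecondCountableTopology L] {τ : L ≃* L}
    (hτ : Continuous τ) : Continuous τ.symm := by
  have hopen : IsOpenMap τ :=
    MonoidHom.isOpenMap_of_sigmaCompact τ.toMonoidHom τ.surjective hτ
  exact (τ.toEquiv.toHomeomorphOfContinuousOpen hτ hopen).symm.continuous

variable [IsTopologicalGroup L] [BorelSpace L]
  [SecondCountableTopology L] [T2Space L] [LocallyCompactSpace L]

/-- A part `E` of `μ` on which the oscillation of `u j` kills all functions of type `χ` in the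
limit carries no mass of type `χ`, if the limit is an image of `μ` under an automorphism that
fixes `T`. -/
theorem UnitEquivariant.setIntegral_eq_zero {μ : Measure L} [IsFiniteMeasure μ] {τ : L ≃* L}
    (hτ : Continuous τ) (hτT : ∀ t ∈ T, τ t = t) {E : Set L} (hE : MeasurableSet E)
    (hET : ∀ (g : L) (t : T), g * (t : L) ∈ E ↔ g ∈ E) {J : Type*} {l : Filter J} [l.NeBot]
    {u : J → L → ℂ} (hu : ∀ j, Measurable (u j)) (hu1 : ∀ j g, ‖u j g‖ ≤ 1)
    (huT : ∀ j g (t : T), u j (g * t) = u j g)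
    (hlim : ∀ f : L →ᵇ ℂ, UnitEquivariant χ f →
      Tendsto (fun j => ∫ g, f g * u j g ∂μ) l (𝓝 (∫ g, f (τ g) ∂μ)))
    (hlimE : ∀ f : L →ᵇ ℂ, UnitEquivariant χ f →
      Tendsto (fun j => ∫ g in E, f g * u j g ∂μ) l (𝓝 0))
    {f₀ : L → ℂ} (hf₀ : UnitEquivariant χ f₀) : ∫ g in E, f₀ g ∂μ = 0 := by
  classical
  -- `sSup S` is the mass of type `χ` outside `E`. It will bound the mass of the limit `τ(μ)`, hence
  -- that of all of `μ`.
  set S : Set ℝ := {r | ∃ f : L → ℂ, UnitEquivariant χ f ∧ r = ‖∫ g in Eᶜ, f g ∂μ‖}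
  have hbdd : BddAbove S := by
    refine ⟨μ.real Eᶜ, ?_⟩
    rintro _ ⟨f, hf, rfl⟩
    simpa using norm_setIntegral_le_of_norm_le_const (measure_lt_top μ Eᶜ)
      (fun g _ => hf.norm_le g)
  have h1 : ∀ f : L → ℂ, UnitEquivariant χ f → ‖∫ g in Eᶜ, f g ∂μ‖ ≤ sSup S := fun f hf =>
    le_csSup hbdd ⟨f, hf, rfl⟩
  have h2 : ∀ f : L →ᵇ ℂ, UnitEquivariant χ f → ‖∫ g, f (τ g) ∂μ‖ ≤ sSup S := by
    intro f hf
    have hmul : ∀ j, UnitEquivariant χ (fun g => f g * u j g) := fun j =>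
      hf.mul_invariant (hu j) (hu1 j) (huT j)
    have hsub := (hlim f hf).sub (hlimE f hf)
    rw [sub_zero] at hsub
    refine le_of_tendsto hsub.norm (.of_forall fun j => ?_)
    rw [← integral_add_compl hE ((hmul j).integrable μ), add_sub_cancel_left]
    exact h1 _ (hmul j)
  have h3 : ∀ f : L → ℂ, UnitEquivariant χ f → ‖∫ g, f (τ g) ∂μ‖ ≤ sSup S := by
    intro f hf
    refine le_of_forall_pos_le_add fun ε hε => ?_
    obtain ⟨h, hh, hle⟩ := hf.exists_continuous_approx (μ.map τ) hε
    have e1 := (hf.comp_mulEquiv τ hτ.measurable hτT).integrable μ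
    have e2 := (hh.comp_mulEquiv τ hτ.measurable hτT).integrable μ
    rw [integral_map (f := fun x => ‖f x - h x‖) hτ.measurable.aemeasurable
      (hf.measurable.sub hh.measurable).norm.aestronglyMeasurable] at hle
    calc ‖∫ g, f (τ g) ∂μ‖ = ‖(∫ g, h (τ g) ∂μ) + ∫ g, (f (τ g) - h (τ g)) ∂μ‖ := by
          rw [integral_sub e1 e2, add_sub_cancel]
      _ ≤ ‖∫ g, h (τ g) ∂μ‖ + ‖∫ g, (f (τ g) - h (τ g)) ∂μ‖ := norm_add_le _ _
      _ ≤ sSup S + ε := add_le_add (h2 h hh) ((norm_integral_le_integral_norm _).trans hle)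
  have h4 : ∀ f : L → ℂ, UnitEquivariant χ f → ‖∫ g, f g ∂μ‖ ≤ sSup S := by
    intro f hf
    have := h3 _ (hf.comp_mulEquiv τ.symm (continuous_mulEquiv_symm hτ).measurable
      fun t ht => by rw [MulEquiv.symm_apply_eq, hτT t ht])
    simpa using this
  -- Glue `f₀` on `E` to `f` off `E`, each rotated by a unimodular constant making its integral
  -- nonnegative, so that the norms add.
  have h5 : ∀ f : L → ℂ, UnitEquivariant χ f →
      ‖∫ g in Eᶜ, f g ∂μ‖ + ‖∫ g in E, f₀ g ∂μ‖ ≤ sSup S := by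
    intro f hf
    obtain ⟨a, ha, ha'⟩ := RCLike.exists_norm_eq_mul_self (∫ g in Eᶜ, f g ∂μ)
    obtain ⟨b, hb, hb'⟩ := RCLike.exists_norm_eq_mul_self (∫ g in E, f₀ g ∂μ)
    have hp := (hf₀.const_mul hb.le).piecewise hE hET (hf.const_mul ha.le)
    have hsum := h4 _ hp
    rw [← integral_add_compl hE (hp.integrable μ),
      setIntegral_congr_fun hE (Set.piecewise_eqOn _ _ _),
      setIntegral_congr_fun hE.compl (Set.piecewise_eqOn_compl _ _ _), integral_const_mul,
      integral_const_mul, ← ha', ← hb'] at hsum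
    rw [add_comm]
    refine le_trans (le_of_eq ?_) hsum
    rw [← RCLike.ofReal_add, RCLike.norm_ofReal, abs_of_nonneg (by positivity)]
  have h6 : sSup S ≤ sSup S - ‖∫ g in E, f₀ g ∂μ‖ := by
    refine csSup_le ⟨_, f₀, hf₀, rfl⟩ ?_
    rintro _ ⟨f, hf, rfl⟩
    linarith [h5 f hf]
  exact norm_le_zero_iff.1 (by linarith)

end NormComparison

/-! ### Characters of vector groups -/

section VectorCharacter

variable {V : Type*} [NormedAddCommGroup V] [NormedSpace ℝ V]

/-- The continuous characters of a vector group are exponentials of linear forms. -/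
theorem exists_linear_of_character {φ : V → Circle} (hφ : Continuous φ) (h0 : φ 0 = 1)
    (hadd : ∀ x y, φ (x + y) = φ x * φ y) : ∃ ℓ : V →L[ℝ] ℝ, ∀ x, φ x = Circle.exp (ℓ x) := by
  obtain ⟨F, ⟨hF0, hF⟩, -⟩ := Circle.isCoveringMap_exp.existsUnique_continuousMap_lifts
    (⟨φ, hφ⟩ : C(V, Circle)) 0 0 (by simp [h0])
  have hF' : ∀ x, Circle.exp (F x) = φ x := fun x => congrFun hF x
  have key : (fun p : V × V => F (p.1 + p.2)) = fun p => F p.1 + F p.2 := by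
    -- Both sides lift the same map through the covering `Circle.exp` and agree at the origin.
    refine Circle.isCoveringMap_exp.eq_of_comp_eq (by fun_prop) (by fun_prop) ?_ (0, 0) ?_
    · funext p
      simp only [Function.comp_apply, Circle.exp_add, hF', hadd]
    · simp [hF0]
  let A : V →+ ℝ := AddMonoidHom.mk' F fun x y => congrFun key (x, y)
  exact ⟨A.toRealLinearMap F.continuous, fun x => (hF' x).symm⟩

end VectorCharacter

/-! ### Riemann–Lebesgue lemma through convolution powers -/

section RiemannLebesgue

theorem tendsto_integral_circleExp_mul {V : Type*} [NormedAddCommGroup V] [NormedSpace ℝ V]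
    [FiniteDimensional ℝ V] [MeasurableSpace V] [BorelSpace V] (f : V → ℂ) (m : Measure V)
    [m.IsAddHaarMeasure] {J : Type*} {l : Filter J} {ℓ : J → (V →L[ℝ] ℝ)}
    (hℓ : Tendsto (fun j => ‖ℓ j‖) l atTop) :
    Tendsto (fun j => ∫ v, (Circle.exp (ℓ j v) : ℂ) * f v ∂m) l (𝓝 0) := by
  -- Normalisation: the Fourier kernel is `exp(-2πi w(v))`, to be matched with `exp(i ℓ(v))`.
  let w : J → StrongDual ℝ V := fun j => (-(2 * Real.pi)⁻¹ : ℝ) • ℓ j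
  have hw : Tendsto w l (cocompact (StrongDual ℝ V)) := by
    have : ProperSpace (StrongDual ℝ V) := FiniteDimensional.proper ℝ (StrongDual ℝ V)
    rw [← Metric.cobounded_eq_cocompact, ← tendsto_norm_atTop_iff_cobounded]
    simp_rw [w, norm_smul]
    exact hℓ.const_mul_atTop (by simp [Real.pi_ne_zero])
  refine ((tendsto_integral_exp_smul_cocompact f m).comp hw).congr fun j => ?_
  refine integral_congr_ae (.of_forall fun v => ?_)
  have : 2 * Real.pi * -(w j v) = ℓ j v := by
    simp only [w, smul_apply, smul_eq_mul]
    field_simp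
  simp only [Circle.smul_def, Real.fourierChar_apply', this, smul_eq_mul]

variable {n : ℕ}

instance convPow_isFiniteMeasure (ν : Measure (EuclideanSpace ℝ (Fin n))) [IsFiniteMeasure ν]
    (d : ℕ) : IsFiniteMeasure (convPow ν d) := by
  induction d with
  | zero => unfold convPow; infer_instance
  | succ d ih => unfold convPow; infer_instance

theorem convPow_absolutelyContinuous {ν lam : Measure (EuclideanSpace ℝ (Fin n))}
    [IsFiniteMeasure ν] [IsFiniteMeasure lam] (h : ν ≪ lam) (d : ℕ) :
    convPow ν d ≪ convPow lam d := by
  induction d with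
  | zero => exact Measure.AbsolutelyContinuous.rfl
  | succ d ih =>
    unfold convPow
    exact (ih.prod h).map (measurable_fst.add measurable_snd)

theorem norm_circleExp (x : ℝ) : ‖(Circle.exp x : ℂ)‖ = 1 := Circle.norm_coe _

theorem integral_exp_convPow (ν : Measure (EuclideanSpace ℝ (Fin n))) [IsFiniteMeasure ν]
    (ℓ : EuclideanSpace ℝ (Fin n) →L[ℝ] ℝ) (d : ℕ) :
    ∫ x, (Circle.exp (ℓ x) : ℂ) ∂(convPow ν d) = (∫ x, (Circle.exp (ℓ x) : ℂ) ∂ν) ^ d := by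
  have hcont : Continuous fun x => (Circle.exp (ℓ x) : ℂ) :=
    continuous_subtype_val.comp (Circle.exp.continuous.comp ℓ.continuous)
  induction d with
  | zero => simp [convPow]
  | succ d ih =>
    rw [pow_succ, ← ih, convPow, Measure.conv,
      integral_map (φ := fun p : EuclideanSpace ℝ (Fin n) × EuclideanSpace ℝ (Fin n) => p.1 + p.2)
        (measurable_fst.add measurable_snd).aemeasurable
        hcont.measurable.aestronglyMeasurable]
    simp_rw [_root_.map_add, Circle.exp_add, Circle.coe_mul]
    exact integral_prod_mul (μ := convPow ν d) (ν := ν) (fun x => (Circle.exp (ℓ x) : ℂ))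
      (fun x => (Circle.exp (ℓ x) : ℂ))

/-- The `d`-th convolution power of `ν` is absolutely continuous on `U` because that of `lam` is, so
its Fourier transform decays. That transform is the `d`-th power of the one of `ν`, which therefore
decays too. -/
theorem tendsto_integral_exp_of_hasDensityOn {U : Submodule ℝ (EuclideanSpace ℝ (Fin n))}
    {lam ν : Measure (EuclideanSpace ℝ (Fin n))} [IsFiniteMeasure lam] [IsFiniteMeasure ν]
    (hν : ν ≪ lam) {d : ℕ} (hdens : HasDensityOn U (convPow lam d))
    {J : Type*} {l : Filter J} {ℓ : J → (EuclideanSpace ℝ (Fin n) →L[ℝ] ℝ)}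
    (hℓ : Tendsto (fun j => ‖(ℓ j).comp U.subtypeL‖) l atTop) :
    Tendsto (fun j => ∫ x, (Circle.exp (ℓ j x) : ℂ) ∂ν) l (𝓝 0) := by
  set ρ : Measure (EuclideanSpace ℝ (Fin n)) := (volume : Measure U).map Subtype.val with hρ
  have hemb : MeasurableEmbedding (Subtype.val : U → EuclideanSpace ℝ (Fin n)) :=
    MeasurableEmbedding.subtype_coe U.closed_of_finiteDimensional.measurableSet
  have : SigmaFinite ρ := hemb.sigmaFinite_map
  obtain ⟨f, -, hf⟩ := hdens
  have hac : convPow ν d ≪ ρ :=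
    (convPow_absolutelyContinuous hν d).trans (hf ▸ withDensity_absolutelyContinuous _ _)
  have hpow : Tendsto (fun j => (∫ x, (Circle.exp (ℓ j x) : ℂ) ∂ν) ^ d) l (𝓝 0) := by
    refine (tendsto_integral_circleExp_mul (V := U)
      (fun u : U => (((convPow ν d).rnDeriv ρ u).toReal : ℂ)) volume hℓ).congr fun j => ?_
    rw [← integral_exp_convPow, ← integral_rnDeriv_smul hac, hρ, hemb.integral_map]
    refine integral_congr_ae (.of_forall fun u => ?_)
    simp only [ContinuousLinearMap.comp_apply, Submodule.subtypeL_apply, Complex.real_smul]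
    rw [mul_comm]
  rw [Metric.tendsto_nhds] at hpow ⊢
  intro ε hε
  filter_upwards [hpow (ε ^ d) (pow_pos hε d)] with j hj
  rw [dist_zero_right] at hj ⊢
  rw [norm_pow] at hj
  exact lt_of_pow_lt_pow_left₀ d hε.le hj

end RiemannLebesgue

/-! ### Locally compact second countable groups are Polish -/

theorem polishSpace_of_isRightUniformGroup (G : Type*) [Group G] [UniformSpace G]
    [IsRightUniformGroup G] [T2Space G] [LocallyCompactSpace G] [SecondCountableTopology G] :
    PolishSpace G := by
  have : (uniformity G).IsCountablyGenerated := by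
    rw [IsRightUniformGroup.uniformity_eq]
    infer_instance
  have := IsRightUniformGroup.completeSpace_of_weaklyLocallyCompactSpace (G := G)
  infer_instance

theorem polishSpace_of_locallyCompact_group (G : Type*) [Group G] [TopologicalSpace G]
    [IsTopologicalGroup G] [T2Space G] [LocallyCompactSpace G] [SecondCountableTopology G] :
    PolishSpace G :=
  @polishSpace_of_isRightUniformGroup G _ (IsTopologicalGroup.rightUniformSpace G)
    (@IsRightUniformGroup.mk G (IsTopologicalGroup.rightUniformSpace G) _ ‹_› rfl)
    ‹T2Space G› ‹LocallyCompactSpace G› ‹SecondCountableTopology G›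

/-! ### Functions with a type determine finite measures -/

section Separation

variable {L : Type*} [Group L] [TopologicalSpace L] [IsTopologicalGroup L]
  (T : Subgroup L) [IsCentralTorus T]

/-- The bounded continuous functions on `L` that transform under `T` by some character. -/
def equivariantFunctions : Set (L →ᵇ ℂ) :=
  {f | ∃ χ : T →ₜ* Circle, ∀ (g : L) (t : T), f (g * (t : L)) = χ t * f g}

theorem mul_mem_equivariantFunctions {f f' : L →ᵇ ℂ} (hf : f ∈ equivariantFunctions T)
    (hf' : f' ∈ equivariantFunctions T) : f * f' ∈ equivariantFunctions T := by
  obtain ⟨χ, h⟩ := hf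
  obtain ⟨χ', h'⟩ := hf'
  refine ⟨χ * χ', fun g t => ?_⟩
  have : ((χ * χ') t : ℂ) = χ t * χ' t := Circle.coe_mul _ _
  rw [BoundedContinuousFunction.mul_apply, BoundedContinuousFunction.mul_apply, h, h', this]
  ring

theorem one_mem_equivariantFunctions : (1 : L →ᵇ ℂ) ∈ equivariantFunctions T :=
  ⟨1, fun g t => by simp⟩

theorem star_mem_equivariantFunctions {f : L →ᵇ ℂ} (hf : f ∈ equivariantFunctions T) :
    star f ∈ equivariantFunctions T := by
  obtain ⟨χ, h⟩ := hf
  refine ⟨χ⁻¹, fun g t => ?_⟩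
  have : ((χ⁻¹ : T →ₜ* Circle) t : ℂ) = starRingEnd ℂ (χ t : ℂ) := Circle.coe_inv_eq_conj _
  rw [BoundedContinuousFunction.star_apply, BoundedContinuousFunction.star_apply, h, this]
  simp

variable {T} [T2Space L] [LocallyCompactSpace L] [SecondCountableTopology L]
  [MeasurableSpace L] [BorelSpace L]

theorem isClosed_mul_image (x : L) {s : Set T} (hs : IsClosed s) :
    IsClosed ((fun t : T => x * (t : L)) '' s) := by
  have := IsCentralTorus.compactSpace T
  exact (hs.isCompact.image (continuous_const.mul continuous_subtype_val)).isClosed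

theorem exists_typeProj {s s' : Set L} (hs : IsClosed s) (hs' : IsClosed s') (hd : Disjoint s s')
    {m : Measure T} [IsProbabilityMeasure m] [m.IsMulLeftInvariant] (χ : T →ₜ* Circle) :
    ∃ (u : C(L, ℝ)) (f : L →ᵇ ℂ), f ∈ equivariantFunctions T ∧
      (∀ g, f g = ∫ t : T, starRingEnd ℂ (χ t : ℂ) * u (g * t) ∂m) ∧
      Set.EqOn u 0 s ∧ Set.EqOn u 1 s' ∧ ∀ g, 0 ≤ u g := by
  obtain ⟨u, hu0, hu1, hu⟩ := exists_continuous_zero_one_of_isClosed hs hs' hd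
  have hle : ∀ g, ‖(u g : ℂ)‖ ≤ 1 := fun g => by
    rw [Complex.norm_real, Real.norm_of_nonneg (hu g).1]; exact (hu g).2
  let φ : L →ᵇ ℂ := BoundedContinuousFunction.ofNormedAddCommGroup (fun g => (u g : ℂ))
    (Complex.continuous_ofReal.comp u.continuous) 1 hle
  exact ⟨u, BoundedContinuousFunction.ofNormedAddCommGroup (typeProj m χ φ)
    (continuous_typeProj φ) 1 (norm_typeProj_le hle), ⟨χ, typeProj_map_mul _⟩, fun g => rfl,
    hu0, hu1, fun g => (hu g).1⟩

/-- If `y = x * t`, take `χ` with `χ t ≠ 1` and any `f` of type `χ` with `f x ≠ 0`. Otherwise `xT`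
and `yT` are disjoint compact sets, separated by the `T`-average of a Urysohn function. -/
theorem exists_equivariantFunctions_ne {x y : L} (hxy : x ≠ y) :
    ∃ f ∈ equivariantFunctions T, f x ≠ f y := by
  have := IsCentralTorus.compactSpace T
  obtain ⟨m, hm, hinv, hpos⟩ := IsCentralTorus.exists_haar T
  by_cases h : ∃ t : T, y = x * t
  · obtain ⟨t, rfl⟩ := h
    have ht : t ≠ 1 := by
      rintro rfl
      simp at hxy
    obtain ⟨χ, hχ⟩ := IsCentralTorus.exists_character_ne_one ht
    have hχc : Continuous fun t : T => (χ t : ℂ).re :=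
      Complex.continuous_re.comp (continuous_subtype_val.comp χ.continuous_toFun)
    have hχ1 : ((χ 1 : Circle) : ℂ) = 1 := by rw [_root_.map_one]; rfl
    -- A Urysohn function vanishing at `x * t` for these `t` and equal to one at `x` makes the real
    -- part of the integrand nonnegative, and positive at `t = 1`.
    have hclosed : IsClosed {t : T | (χ t : ℂ).re ≤ 0} := isClosed_le hχc continuous_const
    obtain ⟨u, f, hf, hfu, hu0, hu1, hu⟩ := exists_typeProj (m := m)
      (isClosed_mul_image x hclosed) (isClosed_singleton (x := x)) (by
        rw [Set.disjoint_singleton_right]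
        rintro ⟨s, hs, hs'⟩
        have : s = 1 := by simpa using hs'
        rw [this, Set.mem_ofPred_eq, hχ1] at hs
        norm_num at hs) χ
    refine ⟨f, hf, ?_⟩
    have huc : Continuous fun s : T => u (x * s) :=
      u.continuous.comp (continuous_const.mul continuous_subtype_val)
    have hre : 0 < (f x).re := by
      have hint : Integrable (fun s : T => starRingEnd ℂ (χ s : ℂ) * u (x * s)) m :=
        Continuous.integrable_of_hasCompactSupport
          (continuous_character.mul (Complex.continuous_ofReal.comp huc))
          (HasCompactSupport.of_compactSpace _)
      rw [hfu, ← RCLike.re_eq_complex_re, ← integral_re hint]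
      refine Continuous.integral_pos_of_hasCompactSupport_nonneg_nonzero (x := (1 : T)) ?_
        (HasCompactSupport.of_compactSpace _) (fun s => ?_) ?_
      · exact Complex.continuous_re.comp
          (continuous_character.mul (Complex.continuous_ofReal.comp huc))
      · simp only [RCLike.re_eq_complex_re, Complex.re_mul_ofReal, Complex.conj_re, Pi.zero_apply]
        rcases le_or_gt (χ s : ℂ).re 0 with h0 | h0
        · rw [hu0 ⟨s, h0, rfl⟩]; simp
        · exact mul_nonneg h0.le (hu _)
      · have : u x = 1 := hu1 rfl
        simp [this]
    have hfχ : f (x * t) = χ t * f x := by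
      have : ⇑f = typeProj m χ (fun g => (u g : ℂ)) := funext hfu
      rw [this, typeProj_map_mul]
    rw [hfχ]
    intro heq
    have hne : f x ≠ 0 := fun h => by simp [h] at hre
    have h1 : (χ t : ℂ) = 1 := mul_right_cancel₀ hne (by rw [one_mul]; exact heq.symm)
    exact hχ (Circle.ext h1)
  · obtain ⟨u, f, hf, hfu, hu0, hu1, -⟩ := exists_typeProj (m := m)
      (isClosed_mul_image y (isClosed_univ (X := T))) (isClosed_mul_image x isClosed_univ) (by
        rw [Set.disjoint_left]
        rintro _ ⟨s, -, rfl⟩ ⟨s', -, hs'⟩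
        exact h ⟨s' * s⁻¹, by simp [← mul_assoc, hs']⟩) 1
    refine ⟨f, hf, ?_⟩
    have hy : f y = 0 := by
      rw [hfu]
      have : ∀ s : T, u (y * s) = 0 := fun s => hu0 ⟨s, trivial, rfl⟩
      simp [this]
    have hx : f x = 1 := by
      rw [hfu]
      have : ∀ s : T, u (x * s) = 1 := fun s => hu1 ⟨s, trivial, rfl⟩
      simp [this]
    rw [hx, hy]
    exact one_ne_zero

/-- A finite measure on `L` is determined by the integrals of the functions that transform under
`T` by a character. -/
theorem ext_of_unitEquivariant {μ ν : Measure L} [IsFiniteMeasure μ] [IsFiniteMeasure ν]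
    (h : ∀ (χ : T →ₜ* Circle) (f : L →ᵇ ℂ), UnitEquivariant χ f →
      ∫ g, f g ∂μ = ∫ g, f g ∂ν) : μ = ν := by
  have := polishSpace_of_locallyCompact_group L
  have hint : ∀ f ∈ equivariantFunctions T, ∫ g, f g ∂μ = ∫ g, f g ∂ν := by
    rintro f ⟨χ, hf⟩
    have hc : 0 < ‖f‖ + 1 := by positivity
    have hu : UnitEquivariant χ (((‖f‖ + 1 : ℝ)⁻¹ : ℂ) • f : L →ᵇ ℂ) := by
      refine ⟨(BoundedContinuousFunction.continuous _).measurable, fun g => ?_, fun g t => ?_⟩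
      · rw [BoundedContinuousFunction.smul_apply, norm_smul, norm_inv, Complex.norm_real,
          Real.norm_of_nonneg hc.le, inv_mul_le_iff₀ hc]
        linarith [f.norm_coe_le_norm g]
      · rw [BoundedContinuousFunction.smul_apply, BoundedContinuousFunction.smul_apply, hf,
          smul_eq_mul, smul_eq_mul, mul_left_comm]
    have := h χ _ hu
    simp only [BoundedContinuousFunction.smul_apply, integral_const_mul, smul_eq_mul] at this
    refine mul_left_cancel₀ (inv_ne_zero ?_) this
    exact_mod_cast hc.ne'
  let S : Submonoid (L →ᵇ ℂ) :=
    { carrier := equivariantFunctions T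
      mul_mem' := mul_mem_equivariantFunctions T
      one_mem' := one_mem_equivariantFunctions T }
  let A : StarSubalgebra ℂ (L →ᵇ ℂ) := StarAlgebra.adjoin ℂ (equivariantFunctions T)
  refine ext_of_forall_mem_subalgebra_integral_eq_of_polish (𝕜 := ℂ) (A := A) ?_ ?_
  · intro x y hxy
    obtain ⟨f, hf, hne⟩ := exists_equivariantFunctions_ne (T := T) hxy
    exact ⟨f, ⟨f.toContinuousMap, ⟨f, StarAlgebra.subset_adjoin ℂ _ hf, rfl⟩, rfl⟩, hne⟩
  · intro f hf
    -- Being closed under products and conjugation, these functions span the star algebra they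
    -- generate linearly.
    have hstar : equivariantFunctions T ∪ star (equivariantFunctions T)
        = equivariantFunctions T := by
      refine Set.union_eq_self_of_subset_right fun f hf => ?_
      rw [← star_star f]
      exact star_mem_equivariantFunctions T hf
    have hspan : f ∈ Submodule.span ℂ (equivariantFunctions T) := by
      have h1 : f ∈ Algebra.adjoin ℂ (equivariantFunctions T) := by
        rw [← hstar]; exact hf
      have h2 : f ∈ Subalgebra.toSubmodule (Algebra.adjoin ℂ (equivariantFunctions T)) := h1
      rw [Algebra.adjoin_eq_span] at h2
      have h3 : Submonoid.closure (equivariantFunctions T) = S := Submonoid.closure_eq S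
      rw [h3] at h2
      exact h2
    clear hf
    induction hspan using Submodule.span_induction with
    | mem f hf => exact hint f hf
    | zero => simp
    | add f f' _ _ ih ih' =>
      simp only [BoundedContinuousFunction.add_apply]
      rw [integral_add (f.integrable μ) (f'.integrable μ),
        integral_add (f.integrable ν) (f'.integrable ν), ih, ih']
    | smul c f _ ih =>
      simp only [BoundedContinuousFunction.smul_apply, integral_const_mul, smul_eq_mul, ih]

end Separation

/-! ### Disjoint cells carrying the pure components -/

section Cells

variable {n : ℕ} {ι : Type*} {comp : ι → Measure (EuclideanSpace ℝ (Fin n))}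
  {lam : Measure (EuclideanSpace ℝ (Fin n))}

/-- The part of the span of the `i`-th component that is not covered by the spans of those
components that do not contain it. -/
def pureCell (comp : ι → Measure (EuclideanSpace ℝ (Fin n))) (i : ι) :
    Set (EuclideanSpace ℝ (Fin n)) :=
  (spanSupport (comp i) : Set _) \ ⋃ j, ⋃ (_ : ¬ spanSupport (comp i) ≤ spanSupport (comp j)),
    (spanSupport (comp j) : Set _)

theorem measurableSet_submodule (U : Submodule ℝ (EuclideanSpace ℝ (Fin n))) :
    MeasurableSet (U : Set (EuclideanSpace ℝ (Fin n))) :=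
  U.closed_of_finiteDimensional.measurableSet

theorem pureCell_subset (i : ι) : pureCell comp i ⊆ spanSupport (comp i) := Set.sdiff_subset

theorem disjoint_pureCell_span {i j : ι} (h : ¬ spanSupport (comp i) ≤ spanSupport (comp j)) :
    Disjoint (pureCell comp i) (spanSupport (comp j) : Set _) := by
  rw [Set.disjoint_left]
  intro x hx hxj
  exact hx.2 (Set.mem_iUnion₂.2 ⟨j, h, hxj⟩)

theorem measure_compl_spanSupport (ν : Measure (EuclideanSpace ℝ (Fin n))) :
    ν (spanSupport ν : Set _)ᶜ = 0 :=
  measure_mono_null (Set.compl_subset_compl.2 Submodule.subset_span) Measure.measure_compl_support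

namespace IsPureDecomposition

variable (hc : IsPureDecomposition lam comp)

include hc

theorem isFiniteMeasure [IsFiniteMeasure lam] (i : ι) : IsFiniteMeasure (comp i) := by
  have : comp i ≤ lam := hc.sum_eq ▸ Measure.le_sum comp i
  exact isFiniteMeasure_of_le lam this

theorem measurableSet_pureCell (i : ι) : MeasurableSet (pureCell comp i) := by
  have := hc.countable
  exact (measurableSet_submodule _).diff
    (.iUnion fun j => .iUnion fun _ => measurableSet_submodule _)

theorem pairwise_disjoint_pureCell : Pairwise (Function.onFun Disjoint (pureCell comp)) := by
  intro i j hij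
  by_cases h : spanSupport (comp i) ≤ spanSupport (comp j)
  · have h' : ¬ spanSupport (comp j) ≤ spanSupport (comp i) := fun h' =>
      hc.span_ne i j hij (le_antisymm h h')
    exact ((disjoint_pureCell_span h').mono_right (pureCell_subset i)).symm
  · exact (disjoint_pureCell_span h).mono_right (pureCell_subset j)

theorem measure_span_eq_zero {i j : ι} (h : ¬ spanSupport (comp i) ≤ spanSupport (comp j)) :
    comp i (spanSupport (comp j) : Set _) = 0 := by
  by_contra hne
  exact h (hc.pure i _ (pos_iff_ne_zero.2 hne))

/-- By purity, each span removed from the cell is null for `comp i`, and there are countably many.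
-/
theorem measure_compl_pureCell (i : ι) : comp i (pureCell comp i)ᶜ = 0 := by
  have := hc.countable
  rw [pureCell, Set.compl_sdiff]
  refine measure_union_null ?_ (measure_compl_spanSupport _)
  exact measure_iUnion_null fun j => measure_iUnion_null fun h => hc.measure_span_eq_zero h

theorem measure_pureCell_of_ne {i j : ι} (hij : i ≠ j) : comp j (pureCell comp i) = 0 :=
  measure_mono_null (hc.pairwise_disjoint_pureCell hij).subset_compl_right
    (hc.measure_compl_pureCell j)

theorem measure_compl_iUnion_pureCell : lam (⋃ i, pureCell comp i)ᶜ = 0 := by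
  have := hc.countable
  rw [← hc.sum_eq, Measure.sum_apply _ (MeasurableSet.iUnion hc.measurableSet_pureCell).compl,
    ENNReal.tsum_eq_zero]
  exact fun i => measure_mono_null (Set.compl_subset_compl.2 (Set.subset_iUnion _ i))
    (hc.measure_compl_pureCell i)

/-- Every other component lives on its own cell, so only `comp i` charges this one. -/
theorem restrict_absolutelyContinuous (i : ι) : lam.restrict (pureCell comp i) ≪ comp i := by
  classical
  refine Measure.AbsolutelyContinuous.mk fun s hs h0 => ?_
  rw [Measure.restrict_apply hs, ← hc.sum_eq,
    Measure.sum_apply _ (hs.inter (hc.measurableSet_pureCell i)), ENNReal.tsum_eq_zero]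
  intro j
  by_cases hij : i = j
  · subst hij
    exact measure_mono_null Set.inter_subset_left h0
  · exact measure_mono_null Set.inter_subset_right (hc.measure_pureCell_of_ne hij)

end IsPureDecomposition

end Cells

/-! ### Decay of oscillating integrals over `L` -/

section Oscillation

variable {n : ℕ} {X : Type*} [MeasurableSpace X]

/-- A nonnegative weight can be absorbed into `M`; the image of the weighted measure in `W` is still
absolutely continuous with respect to `lam`. -/
theorem tendsto_integral_smul_exp {U : Submodule ℝ (EuclideanSpace ℝ (Fin n))}
    {lam : Measure (EuclideanSpace ℝ (Fin n))} [IsFiniteMeasure lam] {d : ℕ}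
    (hdens : HasDensityOn U (convPow lam d)) {M : Measure X} [IsFiniteMeasure M]
    {θ : X → EuclideanSpace ℝ (Fin n)} (hθ : Measurable θ) (hM : M.map θ ≪ lam)
    {J : Type*} {l : Filter J} {ℓ : J → (EuclideanSpace ℝ (Fin n) →L[ℝ] ℝ)}
    (hℓ : Tendsto (fun j => ‖(ℓ j).comp U.subtypeL‖) l atTop) {h : X → NNReal}
    (hh : Measurable h) (h1 : ∀ x, h x ≤ 1) :
    Tendsto (fun j => ∫ x, h x • (Circle.exp (ℓ j (θ x)) : ℂ) ∂M) l (𝓝 0) := by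
  have hfin : IsFiniteMeasure (M.withDensity fun x => (h x : ENNReal)) := by
    refine isFiniteMeasure_withDensity ?_
    refine ((lintegral_mono fun x => ENNReal.coe_le_coe.2 (h1 x)).trans_lt ?_).ne
    simp
  have hac : (M.withDensity fun x => (h x : ENNReal)).map θ ≪ lam :=
    ((withDensity_absolutelyContinuous _ _).map hθ).trans hM
  refine (tendsto_integral_exp_of_hasDensityOn hac hdens hℓ).congr fun j => ?_
  have hcont : Continuous fun x => (Circle.exp (ℓ j x) : ℂ) :=
    continuous_subtype_val.comp (Circle.exp.continuous.comp (ℓ j).continuous)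
  rw [integral_map hθ.aemeasurable hcont.measurable.aestronglyMeasurable,
    integral_withDensity_eq_integral_smul hh]

theorem tendsto_integral_mul_exp {U : Submodule ℝ (EuclideanSpace ℝ (Fin n))}
    {lam : Measure (EuclideanSpace ℝ (Fin n))} [IsFiniteMeasure lam] {d : ℕ}
    (hdens : HasDensityOn U (convPow lam d)) {M : Measure X} [IsFiniteMeasure M]
    {θ : X → EuclideanSpace ℝ (Fin n)} (hθ : Measurable θ) (hM : M.map θ ≪ lam)
    {J : Type*} {l : Filter J} {ℓ : J → (EuclideanSpace ℝ (Fin n) →L[ℝ] ℝ)}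
    (hℓ : Tendsto (fun j => ‖(ℓ j).comp U.subtypeL‖) l atTop) {f : X → ℂ}
    (hf : Measurable f) (h1 : ∀ x, ‖f x‖ ≤ 1) :
    Tendsto (fun j => ∫ x, f x * (Circle.exp (ℓ j (θ x)) : ℂ) ∂M) l (𝓝 0) := by
  -- The values `c = 1, -1, -I, I` give the positive and negative parts of the real and imaginary
  -- parts of `f`.
  have key : ∀ c : ℂ, ‖c‖ ≤ 1 → Tendsto (fun j => ∫ x, (c * f x).re.toNNReal •
      (Circle.exp (ℓ j (θ x)) : ℂ) ∂M) l (𝓝 0) := fun c hc =>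
    tendsto_integral_smul_exp hdens hθ hM hℓ
      (Complex.measurable_re.comp (hf.const_mul c)).real_toNNReal fun x => by
        rw [Real.toNNReal_le_one]
        refine (Complex.re_le_norm _).trans ?_
        rw [norm_mul]
        exact mul_le_one₀ hc (norm_nonneg _) (h1 x)
  have hmeas : ∀ j, Measurable fun x => (Circle.exp (ℓ j (θ x)) : ℂ) := fun j =>
    (continuous_subtype_val.comp
      (Circle.exp.continuous.comp (ℓ j).continuous)).measurable.comp hθ
  have hint : ∀ c : ℂ, ‖c‖ ≤ 1 → ∀ j, Integrable (fun x => (c * f x).re.toNNReal •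
      (Circle.exp (ℓ j (θ x)) : ℂ)) M := fun c hc j => by
    refine Integrable.of_bound ((Complex.measurable_re.comp
      (hf.const_mul c)).real_toNNReal.smul (hmeas j)).aestronglyMeasurable 1 (.of_forall fun x => ?_)
    rw [NNReal.smul_def, norm_smul, norm_circleExp, mul_one, Real.norm_of_nonneg NNReal.zero_le_coe,
      Real.coe_toNNReal']
    refine max_le ((Complex.re_le_norm _).trans ?_) zero_le_one
    rw [norm_mul]
    exact mul_le_one₀ hc (norm_nonneg _) (h1 x)
  have hI : ‖-Complex.I‖ ≤ 1 := by simp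
  have hI' : ‖Complex.I‖ ≤ 1 := by simp
  have hone : ‖(1 : ℂ)‖ ≤ 1 := by simp
  have hone' : ‖(-1 : ℂ)‖ ≤ 1 := by simp
  have hlim := ((key 1 hone).sub (key (-1) hone')).add
    (((key (-Complex.I) hI).sub (key Complex.I hI')).const_mul Complex.I)
  simp only [sub_zero, mul_zero, add_zero] at hlim
  refine hlim.congr fun j => ?_
  have hA : Integrable (fun x => (1 * f x).re.toNNReal • (Circle.exp (ℓ j (θ x)) : ℂ) -
      (-1 * f x).re.toNNReal • (Circle.exp (ℓ j (θ x)) : ℂ)) M :=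
    (hint 1 hone j).sub (hint (-1) hone' j)
  have hB : Integrable (fun x => Complex.I *
      ((-Complex.I * f x).re.toNNReal • (Circle.exp (ℓ j (θ x)) : ℂ) -
      (Complex.I * f x).re.toNNReal • (Circle.exp (ℓ j (θ x)) : ℂ))) M :=
    ((hint _ hI j).sub (hint _ hI' j)).const_mul _
  rw [← integral_sub (hint 1 hone j) (hint _ hone' j),
    ← integral_sub (hint _ hI j) (hint _ hI' j), ← integral_const_mul]
  refine (integral_add hA hB).symm.trans (integral_congr_ae (.of_forall fun x => ?_))
  have hsplit : ∀ r : ℝ, ((r.toNNReal : ℝ) : ℂ) - (((-r).toNNReal : ℝ) : ℂ) = r := fun r => by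
    rw [← Complex.ofReal_sub, Real.coe_toNNReal', Real.coe_toNNReal',
      max_zero_sub_max_neg_zero_eq_self]
  have e1 := hsplit (f x).re
  have e2 := hsplit (f x).im
  simp only [NNReal.smul_def, Complex.real_smul, one_mul, neg_mul, Complex.neg_re, Complex.I_mul_re,
    neg_neg]
  linear_combination (Circle.exp (ℓ j (θ x)) : ℂ) * e1
    + Complex.I * (Circle.exp (ℓ j (θ x)) : ℂ) * e2
    + (Circle.exp (ℓ j (θ x)) : ℂ) * Complex.re_add_im (f x)

end Oscillation

/-! ### Splitting off the bounded part of a sequence of vectors -/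

section BoundedPart

open Module

/-- For a sequence in a finite-dimensional space there is a linear map `p` that keeps the sequence
bounded and does not change the values of the linear forms that are bounded on the sequence. -/
theorem exists_bounded_linearMap {V : Type*} [NormedAddCommGroup V] [NormedSpace ℝ V]
    [FiniteDimensional ℝ V] {J : Type*} (a : J → V) :
    ∃ p : V →ₗ[ℝ] V, (∃ C, ∀ j, ‖p (a j)‖ ≤ C) ∧
      ∀ φ : Dual ℝ V, (∃ C, ∀ j, |φ (a j)| ≤ C) → ∀ v, φ (v - p v) = 0 := by
  let B : Submodule ℝ (Dual ℝ V) :=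
    { carrier := {φ | ∃ C, ∀ j, |φ (a j)| ≤ C}
      zero_mem' := ⟨0, by simp⟩
      add_mem' := by
        rintro φ ψ ⟨C, hC⟩ ⟨D, hD⟩
        exact ⟨C + D, fun j => (abs_add_le _ _).trans (add_le_add (hC j) (hD j))⟩
      smul_mem' := by
        rintro c φ ⟨C, hC⟩
        refine ⟨|c| * C, fun j => ?_⟩
        rw [LinearMap.smul_apply, smul_eq_mul, abs_mul]
        exact mul_le_mul_of_nonneg_left (hC j) (abs_nonneg c) }
  -- `p` is the projection onto `Z` along the common kernel of `B`. A coordinate composed with `p`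
  -- kills that kernel, hence lies in `B` by finite-dimensional duality.
  obtain ⟨Z, hZ⟩ := B.dualCoannihilator.exists_isCompl
  have hmem : ∀ φ : Dual ℝ V, φ ∈ B → ∀ v ∈ B.dualCoannihilator, φ v = 0 := fun φ hφ v hv =>
    (Submodule.mem_dualCoannihilator v).1 hv φ hφ
  refine ⟨Z.projection _ hZ.symm, ?_, fun φ hφ v => hmem φ hφ _ ?_⟩
  · have hcoord : ∀ i, ∃ C, ∀ j,
        |(finBasis ℝ V).coord i (Z.projection _ hZ.symm (a j))| ≤ C := by
      intro i
      have h1 : ((finBasis ℝ V).coord i).comp (Z.projection _ hZ.symm)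
          ∈ B.dualCoannihilator.dualAnnihilator := by
        rw [Submodule.mem_dualAnnihilator]
        intro v hv
        rw [LinearMap.comp_apply, (Submodule.projection_apply_eq_zero_iff hZ.symm).2 hv, map_zero]
      rw [Subspace.dualCoannihilator_dualAnnihilator_eq] at h1
      exact h1
    choose C hC using hcoord
    refine ⟨∑ i, C i * ‖finBasis ℝ V i‖, fun j => ?_⟩
    rw [← (finBasis ℝ V).sum_repr (Z.projection _ hZ.symm (a j))]
    refine norm_sum_le_of_le _ fun i _ => ?_
    rw [norm_smul]
    exact mul_le_mul_of_nonneg_right (hC i j) (norm_nonneg _)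
  · rw [← Submodule.projection_eq_self_sub_projection]
    exact Submodule.projection_apply_mem hZ v

end BoundedPart

/-! ### Linear coordinates on `Hom(W, T)` -/

section Characters

variable {L : Type*} [Group L] [TopologicalSpace L] [IsTopologicalGroup L]
  {T R : Subgroup L} [IsCentralTorus T] [R.Normal] {n : ℕ}
  (e : (L ⧸ R) ≃ₜ* Multiplicative (EuclideanSpace ℝ (Fin n)))

theorem continuous_quotMap : Continuous (quotMap e) :=
  continuous_toAdd.comp (e.continuous.comp continuous_quotient_mk')

theorem quotMap_mul_torus (g : L) (t : T) : quotMap e (g * (t : L)) = quotMap e g := by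
  simp only [quotMap, mk_mul_torus e]

/-- The continuous homomorphism `L / R → T` attached, by means of coordinates of the torus, to a
tuple of linear forms. -/
noncomputable def expHom {k : ℕ} (F : T ≃ₜ* (Fin k → Circle))
    (a : Fin k → (EuclideanSpace ℝ (Fin n) →L[ℝ] ℝ)) : (L ⧸ R) →ₜ* T where
  toFun w := F.symm fun l => Circle.exp (a l (Multiplicative.toAdd (e w)))
  map_one' := by
    rw [map_one, toAdd_one]
    simp only [map_zero, Circle.exp_zero]
    exact map_one F.symm
  map_mul' v w := by
    rw [← map_mul]
    congr 1
    funext l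
    simp [Circle.exp_add]
  continuous_toFun := F.symm.continuous.comp (continuous_pi fun l =>
    Circle.exp.continuous.comp ((a l).continuous.comp (continuous_toAdd.comp e.continuous)))

variable {k : ℕ} (F : T ≃ₜ* (Fin k → Circle))

theorem expHom_mk (a : Fin k → (EuclideanSpace ℝ (Fin n) →L[ℝ] ℝ)) (g : L) :
    expHom e F a (QuotientGroup.mk g) = F.symm fun l => Circle.exp (a l (quotMap e g)) := rfl

theorem expHom_add (a b : Fin k → (EuclideanSpace ℝ (Fin n) →L[ℝ] ℝ)) :
    expHom e F (a + b) = expHom e F a * expHom e F b := by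
  refine ContinuousMonoidHom.ext fun w => ?_
  obtain ⟨g, rfl⟩ := QuotientGroup.mk_surjective w
  have h : (expHom e F a * expHom e F b) (QuotientGroup.mk g)
    = expHom e F a (QuotientGroup.mk g) * expHom e F b (QuotientGroup.mk g) := rfl
  rw [h, expHom_mk, expHom_mk, expHom_mk, ← map_mul]
  congr 1
  funext l
  simp [Circle.exp_add]

theorem continuous_expHom : Continuous (expHom (T := T) e F) := by
  refine ContinuousMonoidHom.continuous_of_continuous_uncurry _ ?_
  refine F.symm.continuous.comp (continuous_pi fun l => Circle.exp.continuous.comp ?_)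
  exact ((continuous_apply l).comp continuous_fst).clm_apply
    (continuous_toAdd.comp (e.continuous.comp continuous_snd))

theorem expHom_surjective : Function.Surjective (expHom (T := T) e F) := by
  intro α
  have h : ∀ l, ∃ a : EuclideanSpace ℝ (Fin n) →L[ℝ] ℝ,
      ∀ x, F (α (e.symm (Multiplicative.ofAdd x))) l = Circle.exp (a x) := fun l => by
    refine exists_linear_of_character ?_ ?_ fun x y => ?_
    · exact (continuous_apply l).comp (F.continuous.comp (α.continuous_toFun.comp
        (e.symm.continuous.comp continuous_ofAdd)))
    · rw [ofAdd_zero, map_one, map_one, map_one, Pi.one_apply]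
    · rw [ofAdd_add, map_mul, map_mul, map_mul, Pi.mul_apply]
  choose a ha using h
  refine ⟨a, ContinuousMonoidHom.ext fun w => ?_⟩
  change F.symm (fun l => Circle.exp (a l (Multiplicative.toAdd (e w)))) = α w
  simp only [← ha, ofAdd_toAdd, ContinuousMulEquiv.symm_apply_apply]

/-- In the coordinates given by `expHom`, composition with a character of `T` is linear. -/
theorem exists_linear_character (χ : T →ₜ* Circle) :
    ∃ Λ : (Fin k → (EuclideanSpace ℝ (Fin n) →L[ℝ] ℝ)) →ₗ[ℝ] (EuclideanSpace ℝ (Fin n) →L[ℝ] ℝ),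
      ∀ a g, χ (expHom e F a (QuotientGroup.mk g)) = Circle.exp (Λ a (quotMap e g)) := by
  -- Pulled back to `ℝᵏ`, the universal cover of the torus, `χ` is the exponential of a linear form
  -- `ℓ`; `Λ` is composition with it.
  obtain ⟨ℓ, hℓ⟩ := exists_linear_of_character
    (φ := fun x : Fin k → ℝ => χ (F.symm fun l => Circle.exp (x l)))
    (χ.continuous_toFun.comp (F.symm.continuous.comp
      (continuous_pi fun l => Circle.exp.continuous.comp (continuous_apply l))))
    (by
      simp only [Pi.zero_apply, Circle.exp_zero]
      exact (congrArg χ (map_one F.symm)).trans (map_one χ))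
    (fun x y => by
      rw [← map_mul, ← map_mul]
      congr 2
      funext l
      simp [Circle.exp_add])
  refine ⟨{ toFun := fun a => ℓ.comp (ContinuousLinearMap.pi a)
            map_add' := fun a b => ?_
            map_smul' := fun c a => ?_ }, fun a g => hℓ _⟩
  · ext x
    exact map_add ℓ (fun l => a l x) (fun l => b l x)
  · ext x
    exact map_smul ℓ c (fun l => a l x)

end Characters

/-! ### Shears tested against functions of type `χ` -/

section Main

variable {L : Type*} [Group L] [TopologicalSpace L] [IsTopologicalGroup L]
  [T2Space L] [LocallyCompactSpace L] [SecondCountableTopology L]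
  [MeasurableSpace L] [BorelSpace L]
  {T R : Subgroup L} [IsCentralTorus T] [R.Normal] {n : ℕ}
  {e : (L ⧸ R) ≃ₜ* Multiplicative (EuclideanSpace ℝ (Fin n))} {μ : FiniteMeasure L}
  {ι : Type*} {comp : ι → Measure (EuclideanSpace ℝ (Fin n))}

theorem measurable_character_mk (χ : T →ₜ* Circle) (α : (L ⧸ R) →ₜ* T) :
    Measurable fun g : L => (χ (α (QuotientGroup.mk g)) : ℂ) :=
  (continuous_subtype_val.comp (χ.continuous_toFun.comp
    (α.continuous_toFun.comp continuous_quotient_mk'))).measurable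

theorem UnitEquivariant.integral_map_shear {χ : T →ₜ* Circle} {f : L → ℂ}
    (hf : UnitEquivariant χ f) (α : (L ⧸ R) →ₜ* T) :
    ∫ g, f g ∂(μ.map (shear e α) : Measure L)
      = ∫ g, f g * (χ (α (QuotientGroup.mk g)) : ℂ) ∂(μ : Measure L) := by
  rw [FiniteMeasure.toMeasure_map, integral_map (φ := shear e α)
    (shear e α).continuous.measurable.aemeasurable
    hf.measurable.aestronglyMeasurable]
  refine integral_congr_ae (.of_forall fun g => ?_)
  simp only [shear_apply, hf.map_mul, mul_comm]

theorem UnitEquivariant.mul_character (e : (L ⧸ R) ≃ₜ* Multiplicative (EuclideanSpace ℝ (Fin n)))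
    {χ : T →ₜ* Circle} {f : L → ℂ} (hf : UnitEquivariant χ f) (α : (L ⧸ R) →ₜ* T) :
    UnitEquivariant χ fun g => f g * (χ (α (QuotientGroup.mk g)) : ℂ) :=
  hf.mul_invariant (measurable_character_mk χ α) (fun _ => (Circle.norm_coe _).le)
    fun g t => by rw [mk_mul_torus e]

/-- Compare integrals of type `χ` cell by cell. On a cell with mass of type `χ` the factor `χ ∘ α`
is one; on any other, both integrals vanish, since `f` times that factor is again of type `χ`. -/
theorem mem_stabilizer_of_forall
    (hcomp : IsPureDecomposition ((μ : Measure L).map (quotMap e)) comp) {α : (L ⧸ R) →ₜ* T}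
    (h : ∀ (χ : T →ₜ* Circle) (i : ι), (∃ f : L → ℂ, UnitEquivariant χ f ∧
      ∫ g in quotMap e ⁻¹' pureCell comp i, f g ∂(μ : Measure L) ≠ 0) →
      ∀ g, quotMap e g ∈ spanSupport (comp i) → χ (α (QuotientGroup.mk g)) = 1) :
    α ∈ stabilizer e μ := by
  have hcount := hcomp.countable
  have hq : Measurable (quotMap e) := (continuous_quotMap e).measurable
  suffices hmap : (μ.map (shear e α) : Measure L) = μ from Subtype.ext hmap
  refine ext_of_unitEquivariant (T := T) fun χ f hf => ?_
  rw [hf.integral_map_shear]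
  have hmeas : ∀ i, MeasurableSet (quotMap e ⁻¹' pureCell comp i) := fun i =>
    hq (hcomp.measurableSet_pureCell i)
  have hdisj : Pairwise (Function.onFun Disjoint fun i => quotMap e ⁻¹' pureCell comp i) :=
    fun i j hij => (hcomp.pairwise_disjoint_pureCell hij).preimage _
  have hrestrict : (μ : Measure L).restrict (⋃ i, quotMap e ⁻¹' pureCell comp i) = μ := by
    refine Measure.restrict_eq_self_of_ae_mem ?_
    rw [ae_iff, ← Set.preimage_iUnion]
    have := hcomp.measure_compl_iUnion_pureCell
    rwa [Measure.map_apply hq (MeasurableSet.iUnion hcomp.measurableSet_pureCell).compl] at this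
  have hf' := hf.mul_character e α
  rw [← hrestrict, integral_iUnion hmeas hdisj (hf'.integrable _).integrableOn,
    integral_iUnion hmeas hdisj (hf.integrable _).integrableOn]
  congr 1 with i
  by_cases hi : ∃ f : L → ℂ, UnitEquivariant χ f ∧
      ∫ g in quotMap e ⁻¹' pureCell comp i, f g ∂(μ : Measure L) ≠ 0
  · refine setIntegral_congr_fun (hmeas i) fun g hg => ?_
    simp only [h χ i hi g (pureCell_subset i hg), Circle.coe_one, mul_one]
  · push Not at hi
    rw [hi _ hf, hi _ hf']

theorem exists_norm_le_of_tendsto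
    (hcomp : IsPureDecomposition ((μ : Measure L).map (quotMap e)) comp)
    {α : ℕ → ((L ⧸ R) →ₜ* T)} {τ : L ≃* L} (hτ : Continuous τ) (hτT : ∀ t ∈ T, τ t = t)
    (hlim : Tendsto (fun j => μ.map (shear e (α j))) atTop (𝓝 (μ.map τ)))
    {i : ι} {d : ℕ} (hdens : HasDensityOn (spanSupport (comp i)) (convPow (comp i) d))
    {χ : T →ₜ* Circle} {f₀ : L → ℂ} (hf₀ : UnitEquivariant χ f₀)
    (hne : ∫ g in quotMap e ⁻¹' pureCell comp i, f₀ g ∂(μ : Measure L) ≠ 0)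
    {ℓ : ℕ → (EuclideanSpace ℝ (Fin n) →L[ℝ] ℝ)}
    (hℓ : ∀ j g, χ (α j (QuotientGroup.mk g)) = Circle.exp (ℓ j (quotMap e g))) :
    ∃ C, ∀ j, ‖(ℓ j).comp (spanSupport (comp i)).subtypeL‖ ≤ C := by
  by_contra hbdd
  push Not at hbdd
  have hq : Measurable (quotMap e) := (continuous_quotMap e).measurable
  set N : ℕ → ℝ := fun j => ‖(ℓ j).comp (spanSupport (comp i)).subtypeL‖
  -- This filter replaces a subsequence along which `N` tends to infinity: it is proper as `N` is
  -- unbounded, and finer than `atTop` as it avoids each single index.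
  have hneBot : (Filter.comap N atTop).NeBot := by
    rw [comap_neBot_iff_frequently, frequently_atTop]
    intro C
    obtain ⟨j, hj⟩ := hbdd C
    exact ⟨_, hj.le, j, rfl⟩
  have hle : Filter.comap N atTop ≤ atTop := by
    rw [← Nat.cofinite_eq_atTop, le_cofinite_iff_compl_singleton_mem]
    intro j
    refine ⟨Set.Ioi (N j), Ioi_mem_atTop _, fun j' hj' => ?_⟩
    rintro rfl
    exact lt_irrefl (N j') hj'
  have hcell : MeasurableSet (quotMap e ⁻¹' pureCell comp i) :=
    hq (hcomp.measurableSet_pureCell i)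
  have := hcomp.isFiniteMeasure i
  refine hne (hf₀.setIntegral_eq_zero (l := Filter.comap N atTop)
    (u := fun j g => (χ (α j (QuotientGroup.mk g)) : ℂ)) hτ hτT hcell (fun g t => ?_)
    (fun j => measurable_character_mk χ (α j)) (fun j g => (Circle.norm_coe _).le)
    (fun j g t => ?_) (fun f hf => ?_) fun f hf => ?_)
  · rw [Set.mem_preimage, Set.mem_preimage, quotMap_mul_torus]
  · rw [mk_mul_torus e]
  · have := ((FiniteMeasure.tendsto_iff_forall_integral_rclike_tendsto ℂ).1 hlim f).mono_left hle
    simp only [hf.integral_map_shear] at this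
    rwa [FiniteMeasure.toMeasure_map, integral_map hτ.measurable.aemeasurable
      hf.measurable.aestronglyMeasurable] at this
  · simp only [hℓ]
    refine tendsto_integral_mul_exp hdens hq ?_ tendsto_comap hf.measurable hf.norm_le
    rw [← Measure.restrict_map hq (hcomp.measurableSet_pureCell i)]
    exact hcomp.restrict_absolutelyContinuous i

end Main

end ShearAsymptotics

open ShearAsymptotics in
theorem theorem4p3 {L : Type*} [Group L] [TopologicalSpace L] [IsTopologicalGroup L]
    [T2Space L] [LocallyCompactSpace L] [SecondCountableTopology L]
    [MeasurableSpace L] [BorelSpace L]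
    (T : Subgroup L) [IsCentralTorus T]
    (R : Subgroup L) [R.Normal] (hR : IsClosed (R : Set L))
    (n : ℕ) (e : (L ⧸ R) ≃ₜ* Multiplicative (EuclideanSpace ℝ (Fin n)))
    (μ : FiniteMeasure L)
    {ι : Type*} (comp : ι → Measure (EuclideanSpace ℝ (Fin n)))
    (hcomp : IsPureDecomposition ((μ : Measure L).map (quotMap e)) comp)
    (hdens : ∀ i, ∃ d : ℕ, 0 < d ∧ HasDensityOn (spanSupport (comp i)) (convPow (comp i) d))
    (α : ℕ → ((L ⧸ R) →ₜ* T))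
    (τ : L ≃* L) (hτ : Continuous τ) (hτT : ∀ t ∈ T, τ t = t)
    (hlim : Tendsto (fun j => μ.map (shear e (α j))) atTop (𝓝 (μ.map τ))) :
    IsCompact (closure (Set.range
      (fun j => (QuotientGroup.mk (α j) : ((L ⧸ R) →ₜ* T) ⧸ stabilizer e μ)))) := by
  obtain ⟨k, ⟨F⟩⟩ := IsCentralTorus.isTorus (T := T)
  choose a ha using fun j => expHom_surjective (T := T) e F (α j)
  obtain ⟨p, ⟨C, hC⟩, hp⟩ := exists_bounded_linearMap a
  have hstab : ∀ v, expHom e F (v - p v) ∈ stabilizer e μ := by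
    intro v
    refine mem_stabilizer_of_forall hcomp fun χ i ⟨f₀, hf₀, hne⟩ g hg => ?_
    obtain ⟨Λ, hΛ⟩ := exists_linear_character e F χ
    obtain ⟨d, -, hd⟩ := hdens i
    obtain ⟨D, hD⟩ := exists_norm_le_of_tendsto hcomp hτ hτT hlim hd hf₀ hne
      (ℓ := fun j => Λ (a j)) fun j g => by rw [← ha j, hΛ]
    -- Evaluation at a point of `W_i` is bounded on the sequence `a`, so it kills `v - p v`.
    let φ : Module.Dual ℝ (Fin k → (EuclideanSpace ℝ (Fin n) →L[ℝ] ℝ)) :=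
      { toFun := fun b => Λ b (quotMap e g)
        map_add' := fun b c => by rw [map_add, add_apply]
        map_smul' := fun r b => by rw [map_smul, smul_apply, RingHom.id_apply] }
    have hφ : φ (v - p v) = 0 := by
      refine hp φ ⟨D * ‖quotMap e g‖, fun j => ?_⟩ v
      have := ((Λ (a j)).comp (spanSupport (comp i)).subtypeL).le_of_opNorm_le (hD j)
        ⟨quotMap e g, hg⟩
      exact this
    have hφ' : Λ (v - p v) (quotMap e g) = 0 := hφ
    rw [hΛ, hφ', Circle.exp_zero]
  have hcont : Continuous fun b => (QuotientGroup.mk (expHom e F b) :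
      ((L ⧸ R) →ₜ* T) ⧸ stabilizer e μ) :=
    continuous_quotient_mk'.comp (continuous_expHom e F)
  refine ((isCompact_closedBall (0 : Fin k → (EuclideanSpace ℝ (Fin n) →L[ℝ] ℝ)) C).image
    hcont).closure_of_subset ?_
  rintro _ ⟨j, rfl⟩
  -- `α j` and the exponential of `p (a j)` differ by an element of `X(μ)`.
  refine ⟨p (a j), by simpa using hC j, ?_⟩
  refine QuotientGroup.eq.2 ?_
  have h := hstab (a j)
  have hsum : α j = expHom e F (p (a j)) * expHom e F (a j - p (a j)) := by
    rw [← expHom_add, add_sub_cancel, ha]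
  rwa [hsum, inv_mul_cancel_left]
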